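/- Let $U\subseteq\mathbb{R}$ be an open interval (bounded or unbounded), and let $f:U\to\mathbb{R}$ be a convex function. Then $f$ can be approximated by real-analytic convex functions in the $C^0$-fine topology; that is, for every continuous function $\varepsilon:U\to(0,\infty)$ there exists a real-analytic convex function $g:U\to\mathbb{R}$ such that $|f(x)-g(x)|\leq\varepsilon(x)$ for all $x\in U$. -/

import Mathlib

open Set Filter Topology MeasureTheory

/-! Subtracting a supporting line at x₀ and treating the two sides of x₀ separately (the left one by
reflection) reduces the problem to a convex f ≥ 0 with f(x₀) = 0, where the target is f to the right
of x₀ and 0 to the left. That target is finely close to a polygon Σ c_k (x - a_k)⁺ with c_k ≥ 0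
(`ConvexOn.exists_sum_ramps`). Each ramp is replaced by ∫ (x - t)⁺ w(t) φ_k(t) dt, where w > 0 is
one analytic weight dominated by the permitted error and w φ_k is a probability density on U,
concentrated near a_k and with mean exactly a_k. The sum is g(x) = ∫ (x - t)⁺ G(t) dt with G = w Σ
c_k φ_k ≥ 0. Hence g is convex, and since g'' = G it is analytic once G is.

Two points need care. The error must be small relative to ε up to the ends of U: because the mean is
exact, away from a_k the error at x sees only the mass lying beyond x as viewed from a_k, and w
makes this mass small (`exists_bump_ramp`). And G must be analytic: the φ_k extend to entire
functions, mixtures of two Gaussians, which are small on complex sectors around the real axis away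
from a_k; as the a_k pass every point of U, the series converges uniformly on complex neighbourhoods
(`analyticAt_tsum_ofReal`). -/

/-! ### Criteria for real analyticity -/

/-- The power series of `G` is integrated term by term on a smaller ball; `f` differs from the
result by a function with zero derivative. -/
theorem AnalyticAt.of_eventually_hasDerivAt {f G : ℝ → ℝ} {x₀ : ℝ} (hG : AnalyticAt ℝ G x₀)
    (hf : ∀ᶠ x in 𝓝 x₀, HasDerivAt f (G x) x) : AnalyticAt ℝ f x₀ := by
  obtain ⟨p, hp⟩ := hG
  rw [hasFPowerSeriesAt_iff] at hp
  have hf' : ∀ᶠ z in 𝓝 (0 : ℝ), HasDerivAt f (G (x₀ + z)) (x₀ + z) := by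
    have : Tendsto (fun z : ℝ => x₀ + z) (𝓝 0) (𝓝 x₀) := by
      have h : Continuous fun z : ℝ => x₀ + z := by fun_prop
      simpa using h.tendsto 0
    exact this.eventually hf
  obtain ⟨R, hR, hball⟩ := Metric.eventually_nhds_iff_ball.1 (hp.and hf')
  set ρ := R / 2 with hρ
  have hρ0 : 0 < ρ := by positivity
  set u : ℕ → ℝ := fun n => |ρ ^ n * p.coeff n| with hu_def
  have hu : Summable u := by
    have := (hball ρ (by rw [mem_ball_zero_iff, Real.norm_of_nonneg hρ0.le]; linarith)).1.summable
    simpa [hu_def] using this.abs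
  set F : ℕ → ℝ → ℝ := fun n z => z ^ (n + 1) * (p.coeff n / (n + 1)) with hF
  have hFd : ∀ n, ∀ y ∈ Metric.ball (0 : ℝ) ρ, HasDerivAt (F n) (y ^ n * p.coeff n) y := by
    intro n y _
    have := ((hasDerivAt_pow (n + 1) y).mul_const (p.coeff n / (n + 1)))
    have hn : (n : ℝ) + 1 ≠ 0 := by positivity
    have e : ((n + 1 : ℕ) : ℝ) * y ^ (n + 1 - 1) * (p.coeff n / (n + 1)) = y ^ n * p.coeff n := by
      rw [Nat.add_sub_cancel]
      push_cast
      field_simp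
    rwa [e] at this
  have hFb : ∀ n, ∀ y ∈ Metric.ball (0 : ℝ) ρ, ‖y ^ n * p.coeff n‖ ≤ u n := by
    intro n y hy
    rw [mem_ball_zero_iff] at hy
    simp only [hu_def]
    rw [Real.norm_eq_abs, abs_mul, abs_mul, abs_pow, abs_pow, abs_of_pos hρ0]
    gcongr
    exact hy.le
  have hc : IsPreconnected (Metric.ball (0 : ℝ) ρ) := (convex_ball 0 ρ).isPreconnected
  have h0 : (0 : ℝ) ∈ Metric.ball (0 : ℝ) ρ := Metric.mem_ball_self hρ0
  have hs0 : Summable fun n => F n 0 := by simp [hF, summable_zero]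
  have hD : ∀ y ∈ Metric.ball (0 : ℝ) ρ,
      HasDerivAt (fun z => ∑' n, F n z) (G (x₀ + y)) y := by
    intro y hy
    have h1 := hasDerivAt_tsum_of_isPreconnected hu Metric.isOpen_ball hc hFd hFb h0 hs0 hy
    have h2 := (hball y (Metric.ball_subset_ball (by linarith) hy)).1.tsum_eq
    simp only [smul_eq_mul] at h2
    rwa [h2] at h1
  have hE : ∀ y ∈ Metric.ball (0 : ℝ) ρ,
      HasDerivAt (fun z => f (x₀ + z) - ∑' n, F n z) 0 y := by
    intro y hy
    have h1 := (hball y (Metric.ball_subset_ball (by linarith) hy)).2.comp_const_add x₀ y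
    have h2 := h1.fun_sub (hD y hy)
    rwa [sub_self] at h2
  have hconst : ∀ y ∈ Metric.ball (0 : ℝ) ρ, f (x₀ + y) = f x₀ + ∑' n, F n y := by
    intro y hy
    have := Metric.isOpen_ball.is_const_of_deriv_eq_zero hc
      (fun z hz => (hE z hz).differentiableAt.differentiableWithinAt)
      (fun z hz => (hE z hz).deriv) hy h0
    have h3 : ∑' n, F n 0 = 0 := by simp [hF]
    simp only [add_zero, h3, sub_zero] at this
    linarith
  set b : ℕ → ℝ := fun n => Nat.casesOn n (f x₀) (fun m => p.coeff m / (m + 1)) with hb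
  refine ⟨FormalMultilinearSeries.ofScalars ℝ b, hasFPowerSeriesAt_iff.2 ?_⟩
  filter_upwards [Metric.ball_mem_nhds (0 : ℝ) hρ0] with y hy
  have hs : Summable fun n => F n y :=
    summable_of_summable_hasDerivAt_of_isPreconnected hu Metric.isOpen_ball hc hFd hFb h0 hs0 hy
  simp only [FormalMultilinearSeries.coeff_ofScalars, smul_eq_mul]
  rw [← hasSum_nat_add_iff' 1]
  have h4 : f (x₀ + y) - ∑ i ∈ Finset.range 1, y ^ i * b i = ∑' n, F n y := by
    rw [hconst y hy]; simp [hb]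
  rw [h4]
  exact hs.hasSum

/-- A locally uniform limit of holomorphic functions is holomorphic, so sup bounds on a complex
neighbourhood suffice and no derivatives are estimated. The bound is needed only for the tail, the
first `N` terms being entire. -/
theorem analyticAt_tsum_ofReal {F : ℕ → ℂ → ℂ} {φ : ℕ → ℝ → ℝ}
    (hF : ∀ k, Differentiable ℂ (F k)) (h : ∀ k (x : ℝ), F k x = φ k x)
    {u : ℕ → ℝ} (hu : Summable u) {V : Set ℂ} (hV : IsOpen V) {N : ℕ}
    (hb : ∀ k ≥ N, ∀ z ∈ V, ‖F k z‖ ≤ u k) {x : ℝ} (hx : (x : ℂ) ∈ V) :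
    Summable (fun k => φ k x) ∧ AnalyticAt ℝ (fun x => ∑' k, φ k x) x := by
  have huN : Summable fun k => u (k + N) := (summable_nat_add_iff N).2 hu
  have hsum : ∀ y : ℝ, (y : ℂ) ∈ V → Summable (fun k => φ k y) := by
    intro y hy
    rw [← summable_nat_add_iff N]
    refine Summable.of_norm_bounded huN fun k => ?_
    have := hb (k + N) (Nat.le_add_left _ _) y hy
    rwa [h, Complex.norm_real] at this
  refine ⟨hsum x hx, ?_⟩
  have hd : DifferentiableOn ℂ (fun z => ∑' k, F (k + N) z) V :=
    Complex.differentiableOn_tsum_of_summable_norm huN (fun k => (hF _).differentiableOn) hV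
      fun k z hz => hb _ (Nat.le_add_left _ _) z hz
  have ha : AnalyticAt ℂ (fun z => ∑ k ∈ Finset.range N, F k z + ∑' k, F (k + N) z) x := by
    refine AnalyticAt.add ?_ (hd.analyticAt (hV.mem_nhds hx))
    exact Finset.analyticAt_fun_sum _ fun k _ => (hF k).analyticAt _
  have hr := ha.re_ofReal
  refine hr.congr ?_
  have hVr : ∀ᶠ y : ℝ in 𝓝 x, (y : ℂ) ∈ V :=
    Complex.continuous_ofReal.continuousAt.eventually (hV.mem_nhds hx)
  filter_upwards [hVr] with y hy
  have : (∑ k ∈ Finset.range N, F k y + ∑' k, F (k + N) y) = ((∑' k, φ k y : ℝ) : ℂ) := by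
    rw [← (hsum y hy).sum_add_tsum_nat_add N]
    push_cast
    simp [h]
  rw [this, Complex.ofReal_re]

/-! ### Escaping sequences and analytic majorants -/

/-- Greedy choice: each step has length 1/(j+1) with the least admissible j. If the sequence stayed
below a point of U, its supremum l would lie in U; one fixed j is admissible at all points just left
of l, so a late step would overshoot l. -/
theorem exists_strictMono_seq_escaping {U : Set ℝ} (hU : IsOpen U) (hUc : U.OrdConnected) {x₀ : ℝ}
    (hx₀ : x₀ ∈ U) {P : ℝ → ℝ → Prop}
    (hP : ∀ y ∈ U, x₀ ≤ y → ∃ ρ > 0, ∀ u v, y - ρ < u → u < v → v < y + ρ → x₀ ≤ u → P u v) :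
    ∃ a : ℕ → ℝ, a 0 = x₀ ∧ StrictMono a ∧ (∀ k, a k ∈ U) ∧ (∀ k, P (a k) (a (k + 1))) ∧
      ∀ y ∈ U, ∃ k, y < a k := by
  classical
  set Q : ℝ → ℕ → Prop := fun a j => a + 1 / ((j : ℝ) + 1) ∈ U ∧ P a (a + 1 / ((j : ℝ) + 1)) with hQ
  have key : ∀ y ∈ U, x₀ ≤ y → ∃ ρ > 0, ∃ j : ℕ, 1 / ((j : ℝ) + 1) < ρ ∧
      ∀ u, y - ρ < u → u ≤ y → x₀ ≤ u → Q u j := by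
    intro y hy hxy
    obtain ⟨ρ, hρ, h⟩ := hP y hy hxy
    obtain ⟨r, hr, hrU⟩ := Metric.isOpen_iff.1 hU y hy
    obtain ⟨j, hj⟩ := exists_nat_one_div_lt (lt_min hρ hr)
    have hj0 : 0 < 1 / ((j : ℝ) + 1) := by positivity
    refine ⟨min ρ r, lt_min hρ hr, j, hj, fun u hu1 hu2 hu3 => ⟨hrU ?_, h _ _ ?_ ?_ ?_ hu3⟩⟩
    · rw [Metric.mem_ball, Real.dist_eq, abs_lt]
      have := min_le_right ρ r
      constructor <;> linarith
    all_goals have := min_le_left ρ r; linarith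
  have hex : ∀ y : {y // y ∈ U ∧ x₀ ≤ y}, ∃ j, Q y j := by
    rintro ⟨y, hy, hxy⟩
    obtain ⟨ρ, hρ, j, -, h⟩ := key y hy hxy
    exact ⟨j, h y (by linarith) le_rfl hxy⟩
  set step : {y // y ∈ U ∧ x₀ ≤ y} → {y // y ∈ U ∧ x₀ ≤ y} := fun y =>
    ⟨y + 1 / ((Nat.find (hex y) : ℝ) + 1), (Nat.find_spec (hex y)).1, by
      have h1 := y.2.2
      have h2 : 0 < 1 / ((Nat.find (hex y) : ℝ) + 1) := by positivity
      linarith⟩ with hstep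
  set s : ℕ → {y // y ∈ U ∧ x₀ ≤ y} := fun n => step^[n] ⟨x₀, hx₀, le_rfl⟩ with hs
  have hs1 : ∀ n, s (n + 1) = step (s n) := fun n => Function.iterate_succ_apply' _ _ _
  have hmono : StrictMono fun n => (s n : ℝ) := by
    refine strictMono_nat_of_lt_succ fun n => ?_
    rw [hs1]
    have h2 : 0 < 1 / ((Nat.find (hex (s n)) : ℝ) + 1) := by positivity
    simp only [hstep]
    linarith
  refine ⟨fun n => s n, rfl, hmono, fun k => (s k).2.1, fun k => ?_, ?_⟩
  · change P (s k) (s (k + 1))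
    rw [hs1]
    exact (Nat.find_spec (hex (s k))).2
  · by_contra! hcon
    obtain ⟨y, hyU, hy⟩ := hcon
    have hbdd : BddAbove (range fun n => (s n : ℝ)) := ⟨y, by rintro _ ⟨k, rfl⟩; exact hy k⟩
    set l := ⨆ n, (s n : ℝ) with hl
    have hle : ∀ n, (s n : ℝ) ≤ l := fun n => le_ciSup hbdd n
    have hl0 : x₀ ≤ l := (s 0).2.2.trans (hle 0)
    have hlU : l ∈ U := hUc.out hx₀ hyU ⟨hl0, ciSup_le hy⟩
    obtain ⟨ρ, hρ, j, hj, h⟩ := key l hlU hl0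
    have hj0 : 0 < 1 / ((j : ℝ) + 1) := by positivity
    obtain ⟨n, hn⟩ := exists_lt_of_lt_ciSup (show l - 1 / ((j : ℝ) + 1) < ⨆ n, (s n : ℝ) by
      rw [← hl]; linarith)
    have hq := h (s n) (by linarith) (hle n) (s n).2.2
    have hfind : Nat.find (hex (s n)) ≤ j := Nat.find_min' _ hq
    have h3 := hle (n + 1)
    rw [hs1] at h3
    simp only [hstep] at h3
    have h4 : 1 / ((j : ℝ) + 1) ≤ 1 / ((Nat.find (hex (s n)) : ℝ) + 1) := by
      gcongr
    linarith

/-- The majorant is a constant plus Σ exp(N_k (x - a_k)). A large rate N_k makes the k-th term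
exceed the bound for `M` on the next cell from a_{k+1} on, yet stay below e^{-k} left of a_{k-1},
also for complex arguments. -/
theorem exists_analytic_majorant_right {U : Set ℝ} (hU : IsOpen U) (hUc : U.OrdConnected) {x₀ : ℝ}
    (hx₀ : x₀ ∈ U) {M : ℝ → ℝ} (hM : ∀ y ∈ U, ∀ z ∈ U, BddAbove (M '' Icc y z)) :
    ∃ E : ℝ → ℝ, AnalyticOnNhd ℝ E U ∧ (∀ x, 0 ≤ E x) ∧ ∀ x ∈ U, x₀ ≤ x → M x ≤ E x := by
  obtain ⟨a, ha0, hmono, haU, -, hesc⟩ := exists_strictMono_seq_escaping hU hUc hx₀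
    (P := fun _ _ => True) fun y _ _ => ⟨1, one_pos, fun _ _ _ _ _ _ => trivial⟩
  have hB : ∀ k, ∃ B : ℝ, 0 ≤ B ∧ ∀ x ∈ Icc (a k) (a (k + 1)), M x ≤ B := by
    intro k
    obtain ⟨B, hB⟩ := hM _ (haU k) _ (haU (k + 1))
    exact ⟨max B 0, le_max_right _ _, fun x hx => (hB ⟨x, hx, rfl⟩).trans (le_max_left _ _)⟩
  choose B hB0 hB using hB
  have hN : ∀ k, ∃ N : ℝ, 0 ≤ N ∧ B (k + 1) ≤ N * (a (k + 1) - a k) ∧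
      k ≤ N * (a k - a (k - 1)) := by
    intro k
    have h1 : 0 < a (k + 1) - a k := sub_pos.2 (hmono k.lt_succ_self)
    rcases Nat.eq_zero_or_pos k with rfl | hk
    · refine ⟨B 1 / (a 1 - a 0), div_nonneg (hB0 1) h1.le, ?_, by simp⟩
      rw [zero_add, div_mul_cancel₀ _ h1.ne']
    · have h2 : 0 < a k - a (k - 1) := sub_pos.2 (hmono (by omega))
      refine ⟨max (B (k + 1) / (a (k + 1) - a k)) (k / (a k - a (k - 1))),
        le_max_of_le_right (by positivity), ?_, ?_⟩
      · rw [← div_le_iff₀ h1]; exact le_max_left _ _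
      · rw [← div_le_iff₀ h2]; exact le_max_right _ _
  choose N hN0 hN1 hN2 using hN
  set F : ℕ → ℂ → ℂ := fun k z => Complex.exp (N k * (z - a k)) with hF
  set φ : ℕ → ℝ → ℝ := fun k x => Real.exp (N k * (x - a k)) with hφ
  have hFd : ∀ k, Differentiable ℂ (F k) := fun k => by simp only [hF]; fun_prop
  have hFφ : ∀ k (x : ℝ), F k x = φ k x := fun k x => by simp [hF, hφ]
  have hu : Summable fun k : ℕ => Real.exp (-k) := Real.summable_exp_neg_nat
  have hloc : ∀ x ∈ U, Summable (fun k => φ k x) ∧ AnalyticAt ℝ (fun x => ∑' k, φ k x) x := by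
    intro x hx
    obtain ⟨m, hm⟩ := hesc x hx
    refine analyticAt_tsum_ofReal hFd hFφ hu (V := {z | z.re < a m})
      (isOpen_lt Complex.continuous_re continuous_const) (N := m + 1) ?_ (by simpa using hm)
    intro k hk z hz
    simp only [hF, Complex.norm_exp]
    have h1 : ((N k : ℂ) * (z - a k)).re = N k * (z.re - a k) := by simp
    rw [h1]
    refine Real.exp_le_exp.2 ?_
    have h2 : a m ≤ a (k - 1) := hmono.monotone (by omega)
    have hz' : z.re < a m := hz
    have h3 : N k * (z.re - a k) ≤ N k * (a (k - 1) - a k) := by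
      gcongr
      · exact hN0 k
      · linarith
    have := hN2 k
    linarith
  refine ⟨fun x => B 0 + ∑' k, φ k x, fun x hx => analyticAt_const.add (hloc x hx).2,
    fun x => add_nonneg (hB0 0) (tsum_nonneg fun k => (Real.exp_pos _).le), fun x hx hxx => ?_⟩
  have hex := hesc x hx
  classical
  obtain ⟨n, hn⟩ : ∃ n, Nat.find hex = n + 1 := by
    refine Nat.exists_eq_succ_of_ne_zero fun h => ?_
    have := Nat.find_spec hex
    rw [h, ha0] at this
    linarith
  have h1 : x < a (n + 1) := hn ▸ Nat.find_spec hex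
  have h2 : a n ≤ x := not_lt.1 (Nat.find_min hex (by omega))
  have h3 : M x ≤ B n := hB n x ⟨h2, h1.le⟩
  have hφ0 : ∀ k, 0 ≤ φ k x := fun k => (Real.exp_pos _).le
  rcases Nat.eq_zero_or_pos n with rfl | hpos
  · exact h3.trans (le_add_of_nonneg_right (tsum_nonneg hφ0))
  · obtain ⟨k, rfl⟩ := Nat.exists_eq_succ_of_ne_zero hpos.ne'
    have h4 : B (k + 1) ≤ φ k x := by
      have h5 : N k * (a (k + 1) - a k) ≤ N k * (x - a k) := by
        gcongr
        exact hN0 k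
      have h6 := Real.add_one_le_exp (N k * (x - a k))
      have h7 := hN1 k
      simp only [hφ]
      linarith
    have h8 : φ k x ≤ ∑' k, φ k x := (hloc x hx).1.le_tsum k fun j _ => hφ0 j
    have := hB0 0
    simp only [Nat.succ_eq_add_one] at h3
    linarith

theorem exists_analytic_majorant {U : Set ℝ} (hU : IsOpen U) (hUc : U.OrdConnected)
    {M : ℝ → ℝ} (hM : ∀ y ∈ U, ∀ z ∈ U, BddAbove (M '' Icc y z)) :
    ∃ E : ℝ → ℝ, AnalyticOnNhd ℝ E U ∧ (∀ x, 0 < E x) ∧ ∀ x ∈ U, M x ≤ E x := by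
  rcases U.eq_empty_or_nonempty with rfl | ⟨x₀, hx₀⟩
  · exact ⟨fun _ => 1, by simp [AnalyticOnNhd], fun _ => one_pos, by simp⟩
  obtain ⟨E₁, hE₁, h₁, hm₁⟩ := exists_analytic_majorant_right hU hUc hx₀ hM
  have hcn : (-U).OrdConnected := by
    refine ⟨fun y hy z hz t ht => ?_⟩
    exact hUc.out (Set.mem_neg.1 hz) (Set.mem_neg.1 hy)
      ⟨neg_le_neg ht.2, neg_le_neg ht.1⟩
  obtain ⟨E₂, hE₂, h₂, hm₂⟩ := exists_analytic_majorant_right (U := -U) (M := fun x => M (-x))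
    (x₀ := -x₀) hU.neg hcn (by simpa using hx₀) (by
      intro y hy z hz
      refine (hM _ (Set.mem_neg.1 hz) _ (Set.mem_neg.1 hy)).mono ?_
      rintro _ ⟨t, ht, rfl⟩
      exact ⟨-t, ⟨neg_le_neg ht.2, neg_le_neg ht.1⟩, rfl⟩)
  refine ⟨fun x => 1 + E₁ x + E₂ (-x), fun x hx => ?_, fun x => ?_, fun x hx => ?_⟩
  · refine (analyticAt_const.add (hE₁ x hx)).add ?_
    exact (hE₂ (-x) (by simpa using hx)).fun_comp analyticAt_id.neg
  · have := h₁ x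
    have := h₂ (-x)
    linarith
  · have a1 := h₁ x
    have a2 := h₂ (-x)
    rcases le_total x₀ x with h | h
    · have := hm₁ x hx h
      linarith
    · have := hm₂ (-x) (by simpa using hx) (neg_le_neg h)
      simp only [neg_neg] at this
      linarith

/-! ### The error function and the analytic weight -/

/-- Take the minimum of `ε` over the segment from x₀ to x, capped at 1. Monotonicity on each side of
x₀ later allows comparing the error at x with its values farther out. -/
theorem exists_unimodal_minorant {U : Set ℝ} (hUc : U.OrdConnected) {x₀ : ℝ}
    (hx₀ : x₀ ∈ U) {ε : ℝ → ℝ} (hε : ContinuousOn ε U) (hpos : ∀ x ∈ U, 0 < ε x) :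
    ∃ e : ℝ → ℝ, (∀ x ∈ U, 0 < e x) ∧ (∀ x ∈ U, e x ≤ ε x) ∧ (∀ x, e x ≤ 1) ∧
      AntitoneOn e (U ∩ Ici x₀) ∧ MonotoneOn e (U ∩ Iic x₀) := by
  have hsub : ∀ x ∈ U, uIcc x₀ x ⊆ U := fun x hx => hUc.uIcc_subset hx₀ hx
  have hmin : ∀ x ∈ U, ∃ y ∈ uIcc x₀ x, ∀ z ∈ uIcc x₀ x, ε y ≤ ε z := fun x hx =>
    isCompact_uIcc.exists_isMinOn nonempty_uIcc (hε.mono (hsub x hx))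
  have hbdd : ∀ x ∈ U, BddBelow (ε '' uIcc x₀ x) := by
    intro x hx
    obtain ⟨y, -, hy⟩ := hmin x hx
    exact ⟨ε y, by rintro _ ⟨z, hz, rfl⟩; exact hy z hz⟩
  have hmono : ∀ x ∈ U, ∀ y, uIcc x₀ y ⊆ uIcc x₀ x →
      min (sInf (ε '' uIcc x₀ x)) 1 ≤ min (sInf (ε '' uIcc x₀ y)) 1 := fun x hx y hxy =>
    min_le_min_right _ (csInf_le_csInf (hbdd x hx) (nonempty_uIcc.image _) (image_mono hxy))
  refine ⟨fun x => min (sInf (ε '' uIcc x₀ x)) 1, fun x hx => ?_, fun x hx => ?_,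
    fun x => min_le_right _ _, fun x hx y hy hxy => ?_, fun x hx y hy hxy => ?_⟩
  · obtain ⟨y, hy, hle⟩ := hmin x hx
    refine lt_min ((hpos y (hsub x hx hy)).trans_le ?_) one_pos
    exact le_csInf (nonempty_uIcc.image _) (by rintro _ ⟨z, hz, rfl⟩; exact hle z hz)
  · exact (min_le_left _ _).trans (csInf_le (hbdd x hx) ⟨x, right_mem_uIcc, rfl⟩)
  · refine hmono y hy.1 x (uIcc_subset_uIcc_left ?_)
    rw [uIcc_of_le (hx.2.trans hxy)]
    exact ⟨hx.2, hxy⟩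
  · refine hmono x hx.1 y (uIcc_subset_uIcc_left ?_)
    rw [uIcc_of_ge (hxy.trans hy.2)]
    exact ⟨hxy, hy.2⟩

/-- The weight is the reciprocal of an analytic majorant of (1+|x|)(1+x²)/e(x). This quotient is
bounded on compact intervals without continuity of `e`: by unimodality `e` is at least its smaller
endpoint value. -/
theorem exists_analytic_weight {U : Set ℝ} (hU : IsOpen U) (hUc : U.OrdConnected) {x₀ : ℝ}
    {e : ℝ → ℝ} (he : ∀ x ∈ U, 0 < e x)
    (hea : AntitoneOn e (U ∩ Ici x₀)) (hem : MonotoneOn e (U ∩ Iic x₀)) :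
    ∃ w : ℝ → ℝ, AnalyticOnNhd ℝ w U ∧ (∀ x, 0 < w x) ∧
      ∀ x ∈ U, (1 + |x|) * w x ≤ e x * (1 + x ^ 2)⁻¹ := by
  obtain ⟨E, hE, hE0, hM⟩ := exists_analytic_majorant hU hUc
    (M := fun x => (1 + |x|) * (1 + x ^ 2) / e x) (by
      intro y hy z hz
      have hc : Continuous fun x : ℝ => (1 + |x|) * (1 + x ^ 2) := by fun_prop
      obtain ⟨B, hB⟩ := (isCompact_Icc (a := y) (b := z)).bddAbove_image hc.continuousOn
      refine ⟨B / min (e y) (e z), ?_⟩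
      rintro _ ⟨x, hx, rfl⟩
      have hxU : x ∈ U := hUc.out hy hz hx
      have h1 : min (e y) (e z) ≤ e x := by
        rcases le_total x₀ x with h | h
        · exact (min_le_right _ _).trans (hea ⟨hxU, h⟩ ⟨hz, h.trans hx.2⟩ hx.2)
        · exact (min_le_left _ _).trans (hem ⟨hy, hx.1.trans h⟩ ⟨hxU, h⟩ hx.1)
      have h2 : (1 + |x|) * (1 + x ^ 2) ≤ B := hB ⟨x, hx, rfl⟩
      have h3 : 0 < min (e y) (e z) := lt_min (he y hy) (he z hz)
      have h4 : 0 ≤ (1 + |x|) * (1 + x ^ 2) := by positivity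
      exact div_le_div₀ (h4.trans h2) h2 h3 h1)
  refine ⟨fun x => (E x)⁻¹, fun x hx => (hE x hx).inv (hE0 x).ne', fun x => inv_pos.2 (hE0 x),
    fun x hx => ?_⟩
  have h1 := hM x hx
  have h2 := he x hx
  have h3 := hE0 x
  have h4 : 0 < 1 + x ^ 2 := by positivity
  rw [div_le_iff₀ h2] at h1
  rw [← div_eq_mul_inv, ← div_eq_mul_inv, div_le_div_iff₀ h3 h4]
  linarith

/-! ### Entire bumps with prescribed mean -/

/-- `φ` is nonnegative, bounded, extends to an entire function `Φ`, and `w * φ` is a probability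
density on `U`. -/
structure IsEntireBump (U : Set ℝ) (w : ℝ → ℝ) (Φ : ℂ → ℂ) (φ : ℝ → ℝ) : Prop where
  differentiable : Differentiable ℂ Φ
  ofReal : ∀ t : ℝ, Φ t = φ t
  nonneg : ∀ t, 0 ≤ φ t
  bounded : ∃ C, ∀ t, φ t ≤ C
  mass : ∫ t in U, w t * φ t = 1

namespace IsEntireBump

variable {U : Set ℝ} {w : ℝ → ℝ} {Φ : ℂ → ℂ} {φ : ℝ → ℝ}

theorem continuous (h : IsEntireBump U w Φ φ) : Continuous φ := by
  have : φ = fun t : ℝ => (Φ t).re := by ext t; rw [h.ofReal, Complex.ofReal_re]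
  rw [this]
  exact Complex.continuous_re.comp (h.differentiable.continuous.comp Complex.continuous_ofReal)

theorem le_of_norm_le (h : IsEntireBump U w Φ φ) {t C : ℝ} (ht : ‖Φ t‖ ≤ C) : φ t ≤ C := by
  rw [h.ofReal, Complex.norm_real] at ht
  exact (le_abs_self _).trans ht

theorem integrableOn_mul (h : IsEntireBump U w Φ φ) {ψ : ℝ → ℝ}
    (hψ : IntegrableOn ψ U) : IntegrableOn (fun t => ψ t * φ t) U := by
  obtain ⟨C, hC⟩ := h.bounded
  refine Integrable.mul_bdd (c := C) hψ h.continuous.aestronglyMeasurable ?_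
  refine Eventually.of_forall fun t => ?_
  rw [Real.norm_of_nonneg (h.nonneg t)]
  exact hC t

theorem convexComb {Φ₁ Φ₂ : ℂ → ℂ} {φ₁ φ₂ : ℝ → ℝ} (hw : IntegrableOn w U)
    (h₁ : IsEntireBump U w Φ₁ φ₁)
    (h₂ : IsEntireBump U w Φ₂ φ₂) {θ : ℝ} (h0 : 0 ≤ θ) (h1 : θ ≤ 1) :
    IsEntireBump U w (fun z => θ * Φ₁ z + (1 - θ : ℝ) * Φ₂ z)
      (fun t => θ * φ₁ t + (1 - θ) * φ₂ t) where
  differentiable := (h₁.differentiable.const_mul _).add (h₂.differentiable.const_mul _)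
  ofReal t := by rw [h₁.ofReal, h₂.ofReal]; push_cast; rfl
  nonneg t := add_nonneg (mul_nonneg h0 (h₁.nonneg t)) (mul_nonneg (sub_nonneg.2 h1) (h₂.nonneg t))
  bounded := by
    obtain ⟨C₁, hC₁⟩ := h₁.bounded
    obtain ⟨C₂, hC₂⟩ := h₂.bounded
    refine ⟨θ * C₁ + (1 - θ) * C₂, fun t => ?_⟩
    have := sub_nonneg.2 h1
    gcongr
    · exact hC₁ t
    · exact hC₂ t
  mass := by
    have e : ∀ t, w t * (θ * φ₁ t + (1 - θ) * φ₂ t) =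
        θ * (w t * φ₁ t) + (1 - θ) * (w t * φ₂ t) := fun t => by ring
    simp_rw [e]
    rw [integral_add ((h₁.integrableOn_mul hw).const_mul _)
      ((h₂.integrableOn_mul hw).const_mul _), integral_const_mul, integral_const_mul,
      h₁.mass, h₂.mass]
    ring

end IsEntireBump

/-- A normalised Gaussian exp(-l(z - s)²)/Z. The hypothesis on Re (z - s)² is exactly what controls
its modulus off the real line. -/
theorem exists_concentrated_bump {U : Set ℝ} (hU : IsOpen U) {w : ℝ → ℝ} (hw0 : ∀ t, 0 < w t)
    (hw : IntegrableOn w U) {s : ℝ} (hs : s ∈ U) {η τ : ℝ} (hη : 0 < η) (hτ : 0 < τ) :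
    ∃ Φ φ, IsEntireBump U w Φ φ ∧ ∀ z : ℂ, η ^ 2 ≤ ((z - s) ^ 2).re → ‖Φ z‖ ≤ τ := by
  obtain ⟨r, hr, hrU⟩ := Metric.isOpen_iff.1 hU s hs
  set ρ := min r (η / 2) with hρ
  have hρ0 : 0 < ρ := lt_min hr (by positivity)
  have hBU : Metric.ball s ρ ⊆ U := (Metric.ball_subset_ball (min_le_left _ _)).trans hrU
  set c := ∫ t in Metric.ball s ρ, w t with hc
  have hc0 : 0 < c := by
    rw [hc, setIntegral_pos_iff_support_of_nonneg_ae
      (Eventually.of_forall fun t => (hw0 t).le) (hw.mono_set hBU)]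
    have : Function.support w = univ := by ext t; simp [(hw0 t).ne']
    rw [this, univ_inter]
    exact Metric.measure_ball_pos _ _ hρ0
  -- Points within η/2 of s give Z ≥ c·exp(-lη²/4), while the numerator is at most exp(-lη²) far
  -- away. The quotient is at most exp(-3lη²/4)/c, so 3lη²/4 = L suffices; the maximum with 0 keeps
  -- l ≥ 0.
  set L := max 0 (-Real.log (τ * c)) with hL
  have hL1 : Real.exp (-L) ≤ τ * c := by
    rw [← Real.le_log_iff_exp_le (by positivity)]
    have := le_max_right 0 (-Real.log (τ * c))
    linarith
  set l := L / (3 * η ^ 2 / 4) with hl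
  have hl0 : 0 ≤ l := div_nonneg (le_max_left _ _) (by positivity)
  have hlL : l * (3 * η ^ 2 / 4) = L := div_mul_cancel₀ _ (by positivity)
  set q : ℝ → ℝ := fun t => Real.exp (-(l * (t - s) ^ 2)) with hq
  have hq0 : ∀ t, 0 < q t := fun t => Real.exp_pos _
  have hq1 : ∀ t, q t ≤ 1 := fun t => Real.exp_le_one_iff.2 (by
    have : 0 ≤ l * (t - s) ^ 2 := by positivity
    linarith)
  have hqc : Continuous q := by simp only [hq]; fun_prop
  have hint : IntegrableOn (fun t => w t * q t) U := by
    refine Integrable.mul_bdd (c := 1) hw hqc.aestronglyMeasurable ?_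
    refine Eventually.of_forall fun t => ?_
    rw [Real.norm_of_nonneg (hq0 t).le]
    exact hq1 t
  set Z := ∫ t in U, w t * q t with hZ
  have hZ1 : Real.exp (-(l * (η ^ 2 / 4))) * c ≤ Z := by
    calc Real.exp (-(l * (η ^ 2 / 4))) * c
        = ∫ t in Metric.ball s ρ, w t * Real.exp (-(l * (η ^ 2 / 4))) := by
          rw [integral_mul_const, mul_comm]
      _ ≤ ∫ t in Metric.ball s ρ, w t * q t := by
          refine setIntegral_mono_on ((hw.mono_set hBU).mul_const _) (hint.mono_set hBU)
            measurableSet_ball fun t ht => ?_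
          refine mul_le_mul_of_nonneg_left (Real.exp_le_exp.2 (neg_le_neg ?_)) (hw0 t).le
          refine mul_le_mul_of_nonneg_left ?_ hl0
          rw [Metric.mem_ball, Real.dist_eq] at ht
          have h1 : |t - s| ≤ η / 2 := ht.le.trans (min_le_right _ _)
          have h2 := sq_abs (t - s)
          have h3 := abs_nonneg (t - s)
          nlinarith
      _ ≤ Z := setIntegral_mono_set hint
          (Eventually.of_forall fun t => (mul_pos (hw0 t) (hq0 t)).le) hBU.eventuallyLE
  have hZ0 : 0 < Z := lt_of_lt_of_le (by positivity) hZ1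
  refine ⟨fun z => Complex.exp (-(l * (z - s) ^ 2)) / Z, fun t => q t / Z,
    ⟨by fun_prop, fun t => by simp [hq], fun t => (div_pos (hq0 t) hZ0).le,
      ⟨1 / Z, fun t => div_le_div_of_nonneg_right (hq1 t) hZ0.le⟩, ?_⟩, fun z hz => ?_⟩
  · simp_rw [← mul_div_assoc]
    rw [integral_div, div_self hZ0.ne']
  · rw [norm_div, Complex.norm_exp, Complex.norm_real, Real.norm_of_nonneg hZ0.le,
      div_le_iff₀ hZ0]
    have h1 : (-((l : ℂ) * (z - s) ^ 2)).re = -(l * ((z - s) ^ 2).re) := by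
      rw [Complex.neg_re, Complex.re_ofReal_mul]
    rw [h1]
    calc Real.exp (-(l * ((z - s) ^ 2).re)) ≤ Real.exp (-(l * η ^ 2)) :=
          Real.exp_le_exp.2 (neg_le_neg (mul_le_mul_of_nonneg_left hz hl0))
      _ = Real.exp (-L) * Real.exp (-(l * (η ^ 2 / 4))) := by
          rw [← Real.exp_add, ← hlL]; ring_nf
      _ ≤ τ * c * Real.exp (-(l * (η ^ 2 / 4))) := by gcongr
      _ ≤ τ * Z := by rw [mul_assoc, mul_comm c]; gcongr

/-- Split the first moment at |t - s| = η/2: the near part is at most η/2 because the mass is 1, the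
far part at most η/4 because `φ` is tiny there and `w` has a finite first moment. -/
theorem exists_bump_mean_near {U : Set ℝ} (hU : IsOpen U) {w : ℝ → ℝ} (hw0 : ∀ t, 0 < w t)
    (hw : IntegrableOn w U) (hw1 : IntegrableOn (fun t => |t| * w t) U)
    {s : ℝ} (hs : s ∈ U) {η τ : ℝ} (hη : 0 < η) (hτ : 0 < τ) :
    ∃ Φ φ, IsEntireBump U w Φ φ ∧ (∀ z : ℂ, (η / 2) ^ 2 ≤ ((z - s) ^ 2).re → ‖Φ z‖ ≤ τ) ∧
      |∫ t in U, (t - s) * (w t * φ t)| < η := by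
  have hK : IntegrableOn (fun t => (|t| + |s|) * w t) U := by
    simp_rw [add_mul]
    exact hw1.add (hw.const_mul _)
  set K := ∫ t in U, (|t| + |s|) * w t with hKdef
  have hK0 : 0 ≤ K := integral_nonneg fun t => mul_nonneg (by positivity) (hw0 t).le
  obtain ⟨Φ, φ, hb, hz⟩ := exists_concentrated_bump hU hw0 hw hs (half_pos hη)
    (lt_min hτ (show 0 < η / (4 * (K + 1)) by positivity))
  refine ⟨Φ, φ, hb, fun z h => (hz z h).trans (min_le_left _ _), ?_⟩
  set τ' := min τ (η / (4 * (K + 1))) with hτ'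
  have hτ'0 : 0 < τ' := lt_min hτ (by positivity)
  have hi1 : IntegrableOn (fun t => η / 2 * (w t * φ t)) U := (hb.integrableOn_mul hw).const_mul _
  have hi2 : IntegrableOn (fun t => τ' * ((|t| + |s|) * w t)) U := hK.const_mul _
  have hle : |∫ t in U, (t - s) * (w t * φ t)| ≤
      ∫ t in U, (η / 2 * (w t * φ t) + τ' * ((|t| + |s|) * w t)) := by
    rw [← Real.norm_eq_abs]
    refine norm_integral_le_of_norm_le (hi1.add hi2) (Eventually.of_forall fun t => ?_)
    have h0 : 0 ≤ w t * φ t := mul_nonneg (hw0 t).le (hb.nonneg t)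
    rw [norm_mul, Real.norm_of_nonneg h0, Real.norm_eq_abs]
    have h2 : |t - s| ≤ |t| + |s| := abs_sub _ _
    rcases le_total |t - s| (η / 2) with h | h
    · have h3 : 0 ≤ τ' * ((|t| + |s|) * w t) :=
        mul_nonneg hτ'0.le (mul_nonneg (by positivity) (hw0 t).le)
      have := mul_le_mul_of_nonneg_right h h0
      linarith
    · have h3 : φ t ≤ τ' := by
        refine hb.le_of_norm_le (hz t ?_)
        have : (((t : ℂ) - s) ^ 2).re = |t - s| ^ 2 := by
          rw [sq_abs, ← Complex.ofReal_sub, ← Complex.ofReal_pow, Complex.ofReal_re]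
        rw [this]
        gcongr
      have h4 : |t - s| * (w t * φ t) ≤ (|t| + |s|) * (w t * τ') := by
        have := (hw0 t).le
        have := hb.nonneg t
        gcongr
      have h5 : 0 ≤ η / 2 * (w t * φ t) := by positivity
      linarith
  refine hle.trans_lt ?_
  rw [integral_add hi1 hi2, integral_const_mul, integral_const_mul, hb.mass, ← hKdef]
  have h6 : τ' * K ≤ η / 4 := by
    calc τ' * K ≤ η / (4 * (K + 1)) * (K + 1) := by
          gcongr
          · exact min_le_right _ _
          · linarith
      _ = η / 4 := by field_simp
  linarith

/-- Bumps near a - ρ and a + ρ have means on opposite sides of a, so some convex combination has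
mean exactly a. -/
theorem exists_centered_bump {U : Set ℝ} (hU : IsOpen U) {w : ℝ → ℝ} (hw0 : ∀ t, 0 < w t)
    (hw : IntegrableOn w U) (hw1 : IntegrableOn (fun t => |t| * w t) U)
    {a : ℝ} (ha : a ∈ U) {η τ : ℝ} (hη : 0 < η) (hτ : 0 < τ) :
    ∃ Φ φ, IsEntireBump U w Φ φ ∧
      (∀ z : ℂ, η ≤ |z.re - a| → |z.im| ≤ |z.re - a| / 4 → ‖Φ z‖ ≤ τ) ∧
      ∫ t in U, (t - a) * (w t * φ t) = 0 := by
  obtain ⟨r, hr, hrU⟩ := Metric.isOpen_iff.1 hU a ha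
  set ρ := min (r / 2) (η / 3) with hρ
  have hρ0 : 0 < ρ := lt_min (by positivity) (by positivity)
  have hρr : ρ ≤ r / 2 := min_le_left _ _
  have hρη : ρ ≤ η / 3 := min_le_right _ _
  have hmem : ∀ s, |s - a| = ρ → s ∈ U := fun s h => hrU (by
    rw [Metric.mem_ball, Real.dist_eq, h]; linarith)
  obtain ⟨Φ₁, φ₁, hb₁, hz₁, hm₁⟩ := exists_bump_mean_near hU hw0 hw hw1
    (hmem (a - ρ) (by rw [sub_sub_cancel_left, abs_neg, abs_of_pos hρ0])) hρ0 hτ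
  obtain ⟨Φ₂, φ₂, hb₂, hz₂, hm₂⟩ := exists_bump_mean_near hU hw0 hw hw1
    (hmem (a + ρ) (by rw [add_sub_cancel_left, abs_of_pos hρ0])) hρ0 hτ
  have hint : ∀ {Φ φ} (b : ℝ), IsEntireBump U w Φ φ →
      IntegrableOn (fun t => (t - b) * (w t * φ t)) U := by
    intro Φ φ b hb
    have h1 : IntegrableOn (fun t => t * w t) U := by
      refine Integrable.mono hw1 (continuous_id.aestronglyMeasurable.mul hw.1) ?_
      exact Eventually.of_forall fun t => by simp
    have h2 : IntegrableOn (fun t => t * w t - b * w t) U := h1.sub (hw.const_mul b)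
    refine (hb.integrableOn_mul h2).congr (Eventually.of_forall fun t => ?_)
    ring
  have hshift : ∀ {Φ φ} (b c : ℝ), IsEntireBump U w Φ φ →
      ∫ t in U, (t - c) * (w t * φ t) = (∫ t in U, (t - b) * (w t * φ t)) + (b - c) := by
    intro Φ φ b c hb
    have : ∀ t, (t - c) * (w t * φ t) = (t - b) * (w t * φ t) + (b - c) * (w t * φ t) :=
      fun t => by ring
    simp_rw [this]
    rw [integral_add (hint b hb) ((hb.integrableOn_mul hw).const_mul _), integral_const_mul,
      hb.mass, mul_one]
  set m₁ := ∫ t in U, (t - a) * (w t * φ₁ t) with hm₁d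
  set m₂ := ∫ t in U, (t - a) * (w t * φ₂ t) with hm₂d
  have h1 : m₁ < 0 := by
    rw [hm₁d, hshift (a - ρ) a hb₁]
    have := (abs_lt.1 hm₁).2
    linarith
  have h2 : 0 < m₂ := by
    rw [hm₂d, hshift (a + ρ) a hb₂]
    have := (abs_lt.1 hm₂).1
    linarith
  set θ := m₂ / (m₂ - m₁) with hθ
  have hd : 0 < m₂ - m₁ := by linarith
  have hθ0 : 0 ≤ θ := div_nonneg h2.le hd.le
  have hθ1 : θ ≤ 1 := (div_le_one hd).2 (by linarith)
  have hθ2 : 0 ≤ 1 - θ := by linarith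
  refine ⟨_, _, hb₁.convexComb hw hb₂ hθ0 hθ1, fun z hre him => ?_, ?_⟩
  -- Since ρ ≤ η/3, moving the centre by ρ keeps at least 2/3 of |Re z - a|, which still dominates
  -- |Im z| in the sector.
  · have key : ∀ s : ℝ, |s - a| = ρ → (ρ / 2) ^ 2 ≤ ((z - s) ^ 2).re := by
      intro s hs
      have e : ((z - s) ^ 2).re = |z.re - s| ^ 2 - |z.im| ^ 2 := by
        rw [sq_abs, sq_abs, pow_two, Complex.mul_re]; simp; ring
      have h3 : |z.re - a| ≤ |z.re - s| + |s - a| := abs_sub_le _ _ _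
      rw [hs] at h3
      have h4 := abs_nonneg z.im
      have h5 : 3 * ρ ≤ |z.re - a| := by linarith
      have h6 : 2 / 3 * |z.re - a| ≤ |z.re - s| := by linarith
      rw [e]
      nlinarith
    have hn₁ := hz₁ z (key _ (by rw [sub_sub_cancel_left, abs_neg, abs_of_pos hρ0]))
    have hn₂ := hz₂ z (key _ (by rw [add_sub_cancel_left, abs_of_pos hρ0]))
    calc ‖(θ : ℂ) * Φ₁ z + (1 - θ : ℝ) * Φ₂ z‖ ≤ θ * ‖Φ₁ z‖ + (1 - θ) * ‖Φ₂ z‖ := by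
          refine (norm_add_le _ _).trans_eq ?_
          rw [norm_mul, norm_mul, Complex.norm_real, Complex.norm_real,
            Real.norm_of_nonneg hθ0, Real.norm_of_nonneg hθ2]
      _ ≤ θ * τ + (1 - θ) * τ := by gcongr
      _ = τ := by ring
  · have e : ∀ t, (t - a) * (w t * (θ * φ₁ t + (1 - θ) * φ₂ t)) =
        θ * ((t - a) * (w t * φ₁ t)) + (1 - θ) * ((t - a) * (w t * φ₂ t)) := fun t => by ring
    simp_rw [e]
    rw [integral_add ((hint a hb₁).const_mul _) ((hint a hb₂).const_mul _), integral_const_mul,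
      integral_const_mul, ← hm₁d, ← hm₂d, hθ]
    field_simp
    ring

/-! ### Smoothing a single ramp -/

/-- For x near a, concentration of the bump gives the bound, as `e` is at least κ there. For x far
from a, the vanishing first moment leaves only the t beyond x, where the weight supplies a factor
e(t) comparable to e(x). -/
theorem exists_bump_ramp {U : Set ℝ} (hU : IsOpen U) {x₀ : ℝ}
    {e w : ℝ → ℝ} (he : ∀ x ∈ U, 0 < e x) (he1 : ∀ x, e x ≤ 1)
    (hea : AntitoneOn e (U ∩ Ici x₀)) (hem : MonotoneOn e (U ∩ Iic x₀))
    (hw0 : ∀ t, 0 < w t) (hw : IntegrableOn w U) (hw1 : IntegrableOn (fun t => |t| * w t) U)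
    (hwe : ∀ x ∈ U, (1 + |x|) * w x ≤ e x * (1 + x ^ 2)⁻¹)
    {a : ℝ} (ha : a ∈ U) (hxa : x₀ ≤ a) {δ η₀ : ℝ} (hδ : 0 < δ) (hη₀ : 0 < η₀) :
    ∃ Φ φ, IsEntireBump U w Φ φ ∧
      (∀ z : ℂ, η₀ ≤ |z.re - a| → |z.im| ≤ |z.re - a| / 4 → ‖Φ z‖ ≤ δ) ∧
      ∀ x ∈ U, |(∫ t in U, max (x - t) 0 * (w t * φ t)) - max (x - a) 0| ≤ δ * e x := by
  obtain ⟨r, hr, hrU⟩ := Metric.isOpen_iff.1 hU a ha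
  have hmem : ∀ s, |s - a| ≤ r / 2 → s ∈ U := fun s h => hrU (by
    rw [Metric.mem_ball, Real.dist_eq]; linarith)
  have hl : a - r / 2 ∈ U := hmem _ (by rw [sub_sub_cancel_left, abs_neg, abs_of_pos (by linarith)])
  have hrr : a + r / 2 ∈ U := hmem _ (by rw [add_sub_cancel_left, abs_of_pos (by linarith)])
  set κ := min (e (a - r / 2)) (e (a + r / 2)) with hκ
  have hκ0 : 0 < κ := lt_min (he _ hl) (he _ hrr)
  have hκle : ∀ x, |x - a| ≤ r / 2 → κ ≤ e x := by
    intro x hx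
    have hxU := hmem x hx
    obtain ⟨h1, h2⟩ := abs_le.1 hx
    rcases le_total x₀ x with h | h
    · exact (min_le_right _ _).trans (hea ⟨hxU, h⟩ ⟨hrr, by simp only [mem_Ici]; linarith⟩ (by linarith))
    · exact (min_le_left _ _).trans (hem ⟨hl, by simp only [mem_Iic]; linarith⟩ ⟨hxU, h⟩ (by linarith))
  set η := min η₀ (min (r / 2) (δ * κ / 2)) with hη
  have hη0 : 0 < η := lt_min hη₀ (lt_min (by positivity) (by positivity))
  have hη1 : η ≤ η₀ := min_le_left _ _
  have hη2 : η ≤ r / 2 := (min_le_right _ _).trans (min_le_left _ _)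
  have hη3 : η ≤ δ * κ / 2 := (min_le_right _ _).trans (min_le_right _ _)
  set D := (1 + |a|) * Real.pi with hD
  have hD0 : 0 < D := by have := Real.pi_pos; positivity
  set τ := min δ (δ * κ / 2 / D) with hτ
  have hτ0 : 0 < τ := lt_min hδ (by positivity)
  have hτD : τ * D ≤ δ * κ / 2 := by
    rw [← le_div_iff₀ hD0]; exact min_le_right _ _
  obtain ⟨Φ, φ, hb, hz, hmean⟩ := exists_centered_bump hU hw0 hw hw1 ha hη0 hτ0
  have hφτ : ∀ t, η ≤ |t - a| → φ t ≤ τ := fun t ht =>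
    hb.le_of_norm_le (hz t (by simpa using ht) (by simp; positivity))
  refine ⟨Φ, φ, hb, fun z h1 h2 => (hz z (hη1.trans h1) h2).trans (min_le_left _ _), ?_⟩
  intro x hx
  have h1w : IntegrableOn (fun t => (1 + |t|) * w t) U := by
    simp_rw [add_mul, one_mul]; exact hw.add hw1
  have hcont : ∀ ψ : ℝ → ℝ, Measurable ψ → (∃ C, ∀ t, |ψ t| ≤ C * (1 + |t|)) →
      IntegrableOn (fun t => ψ t * (w t * φ t)) U := by
    rintro ψ hψ ⟨C, hC⟩
    have h1 : IntegrableOn (fun t => ψ t * w t) U := by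
      refine Integrable.mono' (h1w.const_mul C) (hψ.aestronglyMeasurable.mul hw.1) ?_
      refine Eventually.of_forall fun t => ?_
      rw [norm_mul, Real.norm_of_nonneg (hw0 t).le, Real.norm_eq_abs, ← mul_assoc]
      exact mul_le_mul_of_nonneg_right (hC t) (hw0 t).le
    refine (hb.integrableOn_mul h1).congr (Eventually.of_forall fun t => ?_)
    ring
  -- Adding `J` costs nothing because the density has mean a; it cancels the affine part of the
  -- kernel when x > a.
  set J : ℝ → ℝ := fun t => if a < x then t - a else 0 with hJ
  set κx : ℝ → ℝ := fun t => max (x - t) 0 - max (x - a) 0 + J t with hκx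
  have hJint : ∫ t in U, J t * (w t * φ t) = 0 := by
    by_cases h : a < x
    · simp only [hJ, if_pos h]; exact hmean
    · simp [hJ, if_neg h]
  have i1 : IntegrableOn (fun t => max (x - t) 0 * (w t * φ t)) U := by
    refine hcont _ (by fun_prop) ⟨1 + |x|, fun t => ?_⟩
    rw [abs_of_nonneg (le_max_right _ _)]
    refine max_le ?_ (by positivity)
    have := le_abs_self x
    have := neg_abs_le t
    nlinarith [mul_nonneg (abs_nonneg x) (abs_nonneg t)]
  have i2 : IntegrableOn (fun t => max (x - a) 0 * (w t * φ t)) U :=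
    (hb.integrableOn_mul hw).const_mul _
  have i3 : IntegrableOn (fun t => J t * (w t * φ t)) U := by
    refine hcont _ ?_ ⟨1 + |a|, fun t => ?_⟩
    · simp only [hJ]; split_ifs <;> fun_prop
    · have h3 : |J t| ≤ |t - a| := by
        simp only [hJ]; split_ifs <;> simp
      have h4 : |t - a| ≤ |t| + |a| := abs_sub _ _
      nlinarith [mul_nonneg (abs_nonneg a) (abs_nonneg t)]
  have hrep : (∫ t in U, max (x - t) 0 * (w t * φ t)) - max (x - a) 0 =
      ∫ t in U, κx t * (w t * φ t) := by
    have e1 : ∀ t, κx t * (w t * φ t) = max (x - t) 0 * (w t * φ t) -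
        max (x - a) 0 * (w t * φ t) + J t * (w t * φ t) := fun t => by simp only [hκx]; ring
    have i12 : IntegrableOn (fun t => max (x - t) 0 * (w t * φ t) -
        max (x - a) 0 * (w t * φ t)) U := i1.sub i2
    simp_rw [e1]
    rw [integral_add i12 i3, integral_sub i1 i2, integral_const_mul, hb.mass, hJint]
    ring
  have hcase : ∀ t, κx t = 0 ∨ (|κx t| ≤ |t - a| ∧ (t < x ∧ x ≤ a ∨ a < x ∧ x < t)) := by
    intro t
    simp only [hκx, hJ]
    rcases lt_or_ge a x with h | h
    · rw [if_pos h, max_eq_left (by linarith : (0 : ℝ) ≤ x - a)]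
      rcases lt_or_ge x t with h' | h'
      · right
        rw [max_eq_right (by linarith)]
        refine ⟨?_, Or.inr ⟨h, h'⟩⟩
        rw [abs_of_nonneg (by linarith), abs_of_nonneg (by linarith)]
        linarith
      · left; rw [max_eq_left (by linarith)]; ring
    · rw [if_neg (not_lt.2 h), max_eq_right (by linarith : x - a ≤ 0)]
      rcases lt_or_ge t x with h' | h'
      · right
        rw [max_eq_left (by linarith)]
        refine ⟨?_, Or.inl ⟨h', h⟩⟩
        rw [abs_of_nonneg (by linarith), abs_of_nonpos (by linarith)]
        linarith
      · left; rw [max_eq_right (by linarith)]; ring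
  have hfar : ∀ t ∈ U, η ≤ |t - a| →
      |t - a| * (w t * φ t) ≤ τ * (1 + |a|) * (e t * (1 + t ^ 2)⁻¹) := by
    intro t ht hta
    have h3 : |t - a| ≤ (1 + |a|) * (1 + |t|) := by
      have h4 : |t - a| ≤ |t| + |a| := abs_sub _ _
      nlinarith [mul_nonneg (abs_nonneg a) (abs_nonneg t)]
    have h0 := (hw0 t).le
    have h5 := hb.nonneg t
    calc |t - a| * (w t * φ t) ≤ (1 + |a|) * (1 + |t|) * (w t * τ) := by
          gcongr
          exact hφτ t hta
      _ = τ * (1 + |a|) * ((1 + |t|) * w t) := by ring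
      _ ≤ _ := mul_le_mul_of_nonneg_left (hwe t ht) (by positivity)
  have hLint : Integrable fun t : ℝ => (1 + t ^ 2)⁻¹ := integrable_inv_one_add_sq
  have hπ : ∫ t in U, (1 + t ^ 2)⁻¹ ≤ Real.pi := by
    rw [← integral_univ_inv_one_add_sq]
    exact setIntegral_le_integral hLint (Eventually.of_forall fun t => by positivity)
  have hp0 : ∀ t, 0 ≤ w t * φ t := fun t => mul_nonneg (hw0 t).le (hb.nonneg t)
  rw [hrep, ← Real.norm_eq_abs]
  rcases lt_or_ge |x - a| η with hnear | hfarx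
  · have hκe := hκle x (hnear.le.trans hη2)
    have hi1 : IntegrableOn (fun t => η * (w t * φ t)) U := (hb.integrableOn_mul hw).const_mul _
    have hi2 : IntegrableOn (fun t => τ * (1 + |a|) * (1 + t ^ 2)⁻¹) U :=
      (hLint.const_mul _).integrableOn
    refine (norm_integral_le_of_norm_le (hi1.add hi2)
      ((ae_restrict_mem hU.measurableSet).mono fun t ht => ?_)).trans ?_
    · change ‖κx t * (w t * φ t)‖ ≤ η * (w t * φ t) + τ * (1 + |a|) * (1 + t ^ 2)⁻¹
      rw [norm_mul, Real.norm_of_nonneg (hp0 t), Real.norm_eq_abs]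
      have hq0 : 0 ≤ τ * (1 + |a|) * (1 + t ^ 2)⁻¹ := by positivity
      have h6 := mul_nonneg hη0.le (hp0 t)
      have h7 : |κx t| ≤ |t - a| := by
        rcases hcase t with h | h
        · rw [h, abs_zero]; positivity
        · exact h.1
      have h8 := mul_le_mul_of_nonneg_right h7 (hp0 t)
      rcases lt_or_ge |t - a| η with h | h
      · have := mul_le_mul_of_nonneg_right h.le (hp0 t)
        linarith
      · have h9 := hfar t ht h
        have h10 : τ * (1 + |a|) * (e t * (1 + t ^ 2)⁻¹) ≤ τ * (1 + |a|) * (1 * (1 + t ^ 2)⁻¹) := by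
          gcongr
          exact he1 t
        linarith
    · simp only [Pi.add_apply]
      rw [integral_add hi1 hi2, integral_const_mul, integral_const_mul, hb.mass]
      have h11 : τ * (1 + |a|) * ∫ t in U, (1 + t ^ 2)⁻¹ ≤ τ * D := by
        rw [hD, mul_assoc]
        gcongr
      have h12 : δ * κ ≤ δ * e x := by gcongr
      linarith
  · have hea0 := he a ha
    -- Either e(t) ≤ e(x) or, when x lies between x₀ and a, e(a) ≤ e(x). As `e` ≤ 1, the product
    -- handles both cases.
    have hbound : ∀ t ∈ U, (t < x ∧ x ≤ a ∨ a < x ∧ x < t) → e t * e a ≤ e x := by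
      rintro t ht (⟨h1, h2⟩ | ⟨h1, h2⟩)
      · rcases le_total x₀ x with h | h
        · have h3 := hea ⟨hx, h⟩ ⟨ha, hxa⟩ h2
          have := mul_le_mul (he1 t) h3 hea0.le zero_le_one
          linarith
        · have h3 := hem ⟨ht, h1.le.trans h⟩ ⟨hx, h⟩ h1.le
          have := mul_le_mul h3 (he1 a) hea0.le (he x hx).le
          linarith
      · have h3 := hea ⟨hx, hxa.trans h1.le⟩ ⟨ht, hxa.trans (h1.le.trans h2.le)⟩ h2.le
        have := mul_le_mul h3 (he1 a) hea0.le (he x hx).le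
        linarith
    have hi : IntegrableOn (fun t => τ * (1 + |a|) * (e x / e a) * (1 + t ^ 2)⁻¹) U :=
      (hLint.const_mul _).integrableOn
    have hex := he x hx
    refine (norm_integral_le_of_norm_le hi
      ((ae_restrict_mem hU.measurableSet).mono fun t ht => ?_)).trans ?_
    · rw [norm_mul, Real.norm_of_nonneg (hp0 t), Real.norm_eq_abs]
      rcases hcase t with h | ⟨h, hpos⟩
      · rw [h, abs_zero, zero_mul]; positivity
      · have hta : η ≤ |t - a| := by
          refine hfarx.trans ?_
          rcases hpos with ⟨h1, h2⟩ | ⟨h1, h2⟩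
          · rw [abs_of_nonpos (by linarith), abs_of_nonpos (by linarith)]; linarith
          · rw [abs_of_nonneg (by linarith), abs_of_nonneg (by linarith)]; linarith
        calc |κx t| * (w t * φ t) ≤ |t - a| * (w t * φ t) :=
              mul_le_mul_of_nonneg_right h (hp0 t)
          _ ≤ τ * (1 + |a|) * (e t * (1 + t ^ 2)⁻¹) := hfar t ht hta
          _ ≤ τ * (1 + |a|) * (e x / e a * (1 + t ^ 2)⁻¹) := by
              gcongr
              rw [le_div_iff₀ hea0]
              exact hbound t ht hpos
          _ = _ := by ring
    · rw [integral_const_mul]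
      have hκa : κ ≤ e a := hκle a (by simp; positivity)
      calc τ * (1 + |a|) * (e x / e a) * ∫ t in U, (1 + t ^ 2)⁻¹
          ≤ τ * (1 + |a|) * (e x / e a) * Real.pi := by gcongr
        _ = τ * D * (e x / e a) := by rw [hD]; ring
        _ ≤ δ * e a * (e x / e a) := by
            refine mul_le_mul_of_nonneg_right ?_ (by positivity)
            have : δ * κ ≤ δ * e a := by gcongr
            have : 0 < δ * κ := by positivity
            linarith
        _ = δ * e x := by field_simp

/-! ### Integrals of ramps against a density -/

/-- Cut at some y < p. The part left of y is affine in x, and the rest has second derivative `G`;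
two applications of `AnalyticAt.of_eventually_hasDerivAt` finish. -/
theorem analyticOnNhd_integral_max_sub_mul {U : Set ℝ} (hU : IsOpen U) (hUc : U.OrdConnected)
    {G : ℝ → ℝ} (hG : AnalyticOnNhd ℝ G U)
    (hint : ∀ x ∈ U, IntegrableOn (fun t => max (x - t) 0 * G t) U) :
    AnalyticOnNhd ℝ (fun x => ∫ t in U, max (x - t) 0 * G t) U := by
  intro p hp
  obtain ⟨r, hr, hrU⟩ := Metric.isOpen_iff.1 hU p hp
  set y := p - r / 2 with hy
  have hyp : 0 < p - y := by rw [hy]; linarith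
  have hyU : y ∈ U := hrU (by
    rw [Metric.mem_ball, Real.dist_eq, hy, sub_sub_cancel_left, abs_neg, abs_of_pos (by linarith)]
    linarith)
  have hGc : ContinuousOn G U := hG.continuousOn
  -- `G` is not assumed integrable on U, but left of y the kernel at p is at least p - y > 0 and can
  -- be divided out.
  have hA : IntegrableOn G (U ∩ Iic y) := by
    refine Integrable.mono' (((hint p hp).mono_set inter_subset_left).norm.const_mul (p - y)⁻¹)
      ((hGc.mono inter_subset_left).aestronglyMeasurable
        (hU.measurableSet.inter measurableSet_Iic)) ?_
    refine (ae_restrict_mem (hU.measurableSet.inter measurableSet_Iic)).mono fun t ht => ?_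
    have h1 : p - y ≤ max (p - t) 0 := le_max_of_le_left (sub_le_sub_left ht.2 p)
    rw [norm_mul, Real.norm_of_nonneg (le_max_right _ _), inv_mul_eq_div, le_div_iff₀ hyp, mul_comm]
    exact mul_le_mul_of_nonneg_right h1 (norm_nonneg _)
  have hB : IntegrableOn (fun t => t * G t) (U ∩ Iic y) := by
    have h1 : IntegrableOn (fun t => p * G t - max (p - t) 0 * G t) (U ∩ Iic y) :=
      (hA.const_mul p).sub ((hint p hp).mono_set inter_subset_left)
    refine h1.congr ((ae_restrict_mem (hU.measurableSet.inter measurableSet_Iic)).mono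
      fun t ht => ?_)
    have h2 : t ≤ y := ht.2
    simp only
    rw [max_eq_left (by linarith)]
    ring
  set A := ∫ t in U ∩ Iic y, G t with hAdef
  set B := ∫ t in U ∩ Iic y, t * G t with hBdef
  have hsub : ∀ x ∈ U, uIcc y x ⊆ U := fun x hx => hUc.uIcc_subset hyU hx
  have hii : ∀ x ∈ U, IntervalIntegrable G volume y x := fun x hx =>
    (hGc.mono (hsub x hx)).intervalIntegrable
  have hGc' : ContinuousOn (fun t => t * G t) U := continuousOn_id.mul hGc
  have hii' : ∀ x ∈ U, IntervalIntegrable (fun t => t * G t) volume y x := fun x hx =>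
    (hGc'.mono (hsub x hx)).intervalIntegrable
  have hrep : ∀ x ∈ U, y < x → ∫ t in U, max (x - t) 0 * G t =
      x * A - B + (x * (∫ t in y..x, G t) - ∫ t in y..x, t * G t) := by
    intro x hx hyx
    rw [← integral_inter_add_sdiff measurableSet_Iic (hint x hx) (t := Iic y)]
    congr 1
    · rw [hAdef, hBdef, ← integral_const_mul, ← integral_sub (hA.const_mul x) hB]
      refine setIntegral_congr_fun (hU.measurableSet.inter measurableSet_Iic) fun t ht => ?_
      have h2 : t ≤ y := ht.2
      rw [max_eq_left (by linarith)]
      ring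
    · rw [← intervalIntegral.integral_const_mul,
        ← intervalIntegral.integral_sub ((hii x hx).const_mul x) (hii' x hx),
        intervalIntegral.integral_of_le hyx.le]
      have hsub' : Ioc y x ⊆ U \ Iic y := fun t ht =>
        ⟨hsub x hx (by rw [uIcc_of_le hyx.le]; exact ⟨ht.1.le, ht.2⟩), not_le.2 ht.1⟩
      refine (setIntegral_eq_of_subset_of_forall_sdiff_eq_zero
        (hU.measurableSet.diff measurableSet_Iic) hsub' ?_).trans ?_
      · rintro t ⟨⟨-, h1⟩, h2⟩
        have h3 : x < t := by
          by_contra! h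
          exact h2 ⟨not_le.1 h1, h⟩
        rw [max_eq_right (by linarith), zero_mul]
      · refine setIntegral_congr_fun measurableSet_Ioc fun t ht => ?_
        rw [max_eq_left (by linarith [ht.2])]
        ring
  have hnear : ∀ᶠ x in 𝓝 p, x ∈ U ∧ y < x :=
    (hU.eventually_mem hp).and (lt_mem_nhds (by linarith))
  have hd1 : ∀ x ∈ U, HasDerivAt (fun x => ∫ t in y..x, G t) (G x) x := fun x hx =>
    intervalIntegral.integral_hasDerivAt_right (hii x hx)
      (hGc.stronglyMeasurableAtFilter hU x hx) (hGc.continuousAt (hU.mem_nhds hx))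
  have hd2 : ∀ x ∈ U, HasDerivAt (fun x => ∫ t in y..x, t * G t) (x * G x) x := fun x hx =>
    intervalIntegral.integral_hasDerivAt_right (hii' x hx)
      (hGc'.stronglyMeasurableAtFilter hU x hx) (hGc'.continuousAt (hU.mem_nhds hx))
  have ha1 : AnalyticAt ℝ (fun x => A + ∫ t in y..x, G t) p :=
    (hG p hp).of_eventually_hasDerivAt (hnear.mono fun x hx => (hd1 x hx.1).const_add A)
  refine ha1.of_eventually_hasDerivAt (hnear.eventually_nhds.mono fun x hx => ?_)
  have hxx := hx.self_of_nhds
  refine HasDerivAt.congr_of_eventuallyEq ?_ (hx.mono fun z hz => hrep z hz.1 hz.2)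
  have h1 := (((hasDerivAt_id x).mul_const A).sub_const B).fun_add
    (((hasDerivAt_id x).mul (hd1 x hxx.1)).fun_sub (hd2 x hxx.1))
  refine h1.congr_deriv ?_
  simp

theorem convexOn_integral_max_sub_mul {U : Set ℝ} (hUc : U.OrdConnected)
    {G : ℝ → ℝ} (hG : ∀ t, 0 ≤ G t)
    (hint : ∀ x ∈ U, IntegrableOn (fun t => max (x - t) 0 * G t) U) :
    ConvexOn ℝ U (fun x => ∫ t in U, max (x - t) 0 * G t) := by
  have hc : Convex ℝ U := hUc.convex
  refine ⟨hc, fun x hx y hy a b ha hb hab => ?_⟩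
  simp only [smul_eq_mul]
  rw [← integral_const_mul, ← integral_const_mul,
    ← integral_add ((hint x hx).const_mul a) ((hint y hy).const_mul b)]
  refine integral_mono (hint _ (hc hx hy ha hb hab))
    (((hint x hx).const_mul a).add ((hint y hy).const_mul b)) fun t => ?_
  have h1 : max (a * x + b * y - t) 0 ≤ a * max (x - t) 0 + b * max (y - t) 0 := by
    refine max_le ?_ (by positivity)
    have h2 := mul_le_mul_of_nonneg_left (le_max_left (x - t) 0) ha
    have h3 := mul_le_mul_of_nonneg_left (le_max_left (y - t) 0) hb
    have h4 : t = a * t + b * t := by rw [← add_mul, hab, one_mul]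
    linarith
  have := mul_le_mul_of_nonneg_right h1 (hG t)
  linarith

theorem hasFiniteIntegral_tsum_of_summable_integral_norm {α : Type*} [MeasurableSpace α]
    {μ : Measure α} {F : ℕ → α → ℝ} (hF : ∀ i, Integrable (F i) μ)
    (hs : Summable fun i => ∫ a, ‖F i a‖ ∂μ) : HasFiniteIntegral (fun a => ∑' i, F i a) μ := by
  have h : ∀ i, ∫⁻ a, ‖F i a‖ₑ ∂μ = ENNReal.ofReal (∫ a, ‖F i a‖ ∂μ) := fun i =>
    (ofReal_integral_norm_eq_lintegral_enorm (hF i)).symm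
  calc ∫⁻ a, ‖∑' i, F i a‖ₑ ∂μ ≤ ∫⁻ a, ∑' i, ‖F i a‖ₑ ∂μ :=
        lintegral_mono fun a => enorm_tsum_le_tsum_enorm
    _ = ∑' i, ENNReal.ofReal (∫ a, ‖F i a‖ ∂μ) := by
        rw [lintegral_tsum fun i => (hF i).1.enorm]
        simp_rw [h]
    _ < ⊤ := by
        rw [← ENNReal.ofReal_tsum_of_nonneg
          (fun i => integral_nonneg fun a => norm_nonneg _) hs]
        exact ENNReal.ofReal_lt_top

/-! ### Polygonal approximation -/

/-- A convex function which is nonnegative and vanishes at `x₀` is finely approximated, to the right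
of `x₀`, by a locally finite sum of ramps with nonnegative coefficients. -/
theorem ConvexOn.exists_sum_ramps {U : Set ℝ} (hU : IsOpen U) (hUc : U.OrdConnected) {x₀ : ℝ}
    (hx₀ : x₀ ∈ U) {f : ℝ → ℝ} (hf : ConvexOn ℝ U f) (hf0 : ∀ x ∈ U, 0 ≤ f x) (hfx : f x₀ = 0)
    {e : ℝ → ℝ} (he : ∀ x ∈ U, 0 < e x) (hea : AntitoneOn e (U ∩ Ici x₀)) :
    ∃ a c : ℕ → ℝ, Monotone a ∧ a 0 = x₀ ∧ (∀ k, a k ∈ U) ∧ (∀ y ∈ U, ∃ k, y < a k) ∧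
      (∀ k, 0 ≤ c k) ∧ ∀ x ∈ U, ∃ s, HasSum (fun k => c k * max (x - a k) 0) s ∧
        |s - (if x₀ ≤ x then f x else 0)| ≤ e x / 2 := by
  have hcont := hf.continuousOn hU
  -- The increment of f over a cell is measured against `e` at the right endpoint, the smallest
  -- value of `e` on the cell.
  have hP : ∀ y ∈ U, x₀ ≤ y → ∃ ρ > 0, ∀ u v, y - ρ < u → u < v → v < y + ρ → x₀ ≤ u →
      f v - f u ≤ e v / 2 := by
    intro y hy hxy
    obtain ⟨r, hr, hrU⟩ := Metric.isOpen_iff.1 hU y hy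
    have hmem : ∀ s, |s - y| < r → s ∈ U := fun s h => hrU (by rwa [Metric.mem_ball, Real.dist_eq])
    have hrr : y + r / 2 ∈ U := hmem _ (by
      rw [add_sub_cancel_left, abs_of_pos (by linarith)]; linarith)
    have hκ := he _ hrr
    obtain ⟨ρ, hρ, h⟩ := Metric.continuousAt_iff.1 (hcont.continuousAt (hU.mem_nhds hy))
      (e (y + r / 2) / 4) (by positivity)
    simp only [Real.dist_eq] at h
    refine ⟨min ρ (r / 2), lt_min hρ (by positivity), fun u v h1 h2 h3 h4 => ?_⟩
    have m1 := min_le_left ρ (r / 2)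
    have m2 := min_le_right ρ (r / 2)
    have hu := (abs_lt.1 (h (x := u) (abs_lt.2 ⟨by linarith, by linarith⟩))).1
    have hv := (abs_lt.1 (h (x := v) (abs_lt.2 ⟨by linarith, by linarith⟩))).2
    have hvU : v ∈ U := hmem v (abs_lt.2 ⟨by linarith, by linarith⟩)
    have := hea ⟨hvU, h4.trans h2.le⟩ ⟨hrr, by simp only [mem_Ici]; linarith⟩
      (by linarith : v ≤ y + r / 2)
    linarith
  obtain ⟨a, ha0, hmono, haU, hPa, hesc⟩ := exists_strictMono_seq_escaping hU hUc hx₀ hP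
  have hfmono : ∀ u ∈ U, ∀ v ∈ U, x₀ ≤ u → u ≤ v → f u ≤ f v := by
    intro u hu v hv h1 h2
    have := hf.le_max_of_mem_Icc hx₀ hv ⟨h1, h2⟩
    rwa [hfx, max_eq_right (hf0 v hv)] at this
  set m : ℕ → ℝ := fun k => (f (a (k + 1)) - f (a k)) / (a (k + 1) - a k) with hm
  have hlt : ∀ k, 0 < a (k + 1) - a k := fun k => sub_pos.2 (hmono k.lt_succ_self)
  have hxa : ∀ k, x₀ ≤ a k := fun k => ha0 ▸ hmono.monotone k.zero_le
  have hm0 : ∀ k, 0 ≤ m k := fun k => div_nonneg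
    (sub_nonneg.2 (hfmono _ (haU k) _ (haU _) (hxa k) (hmono k.lt_succ_self).le)) (hlt k).le
  have hmm : ∀ k, m k * (a (k + 1) - a k) = f (a (k + 1)) - f (a k) := fun k =>
    div_mul_cancel₀ _ (hlt k).ne'
  -- These are the slope jumps of the polygon interpolating f at the a_k, nonnegative by convexity;
  -- the first is the full slope `m 0`, since the polygon vanishes left of x₀.
  set c : ℕ → ℝ := fun k => Nat.casesOn k (m 0) (fun j => m (j + 1) - m j) with hc
  have hc0 : ∀ k, 0 ≤ c k := by
    rintro (_ | j)
    · exact hm0 0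
    · exact sub_nonneg.2 (hf.slope_mono_adjacent (haU j) (haU (j + 2))
        (hmono j.lt_succ_self) (hmono (j + 1).lt_succ_self))
  have hsum : ∀ n x, ∑ k ∈ Finset.range (n + 1), c k * (x - a k) = f (a n) + m n * (x - a n) := by
    intro n x
    induction n with
    | zero => simp [hc, ha0, hfx]
    | succ n ih =>
      rw [Finset.sum_range_succ, ih]
      have := hmm n
      simp only [hc]
      linarith
  refine ⟨a, c, hmono.monotone, ha0, haU, hesc, hc0, fun x hx => ?_⟩
  split_ifs with hxx
  · have hex := hesc x hx
    classical
    obtain ⟨n, hn⟩ : ∃ n, Nat.find hex = n + 1 := by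
      refine Nat.exists_eq_succ_of_ne_zero fun h => ?_
      have := Nat.find_spec hex
      rw [h, ha0] at this
      linarith
    have h1 : x < a (n + 1) := hn ▸ Nat.find_spec hex
    have h2 : a n ≤ x := not_lt.1 (Nat.find_min hex (by omega))
    refine ⟨f (a n) + m n * (x - a n), ?_, ?_⟩
    · rw [← hsum n x]
      have h3 : ∑ k ∈ Finset.range (n + 1), c k * (x - a k) =
          ∑ k ∈ Finset.range (n + 1), c k * max (x - a k) 0 := by
        refine Finset.sum_congr rfl fun k hk => ?_
        have : a k ≤ a n := hmono.monotone (by simp at hk; omega)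
        rw [max_eq_left (by linarith)]
      rw [h3]
      refine hasSum_sum_of_ne_finset_zero fun k hk => ?_
      have : a (n + 1) ≤ a k := hmono.monotone (by simpa using hk)
      rw [max_eq_right (by linarith), mul_zero]
    · have h4 : 0 ≤ m n * (x - a n) := mul_nonneg (hm0 n) (by linarith)
      have h5 : m n * (x - a n) ≤ m n * (a (n + 1) - a n) :=
        mul_le_mul_of_nonneg_left (by linarith) (hm0 n)
      have h6 := hmm n
      have h7 := hfmono _ (haU n) x hx (hxa n) h2
      have h8 := hfmono x hx _ (haU (n + 1)) hxx h1.le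
      have h9 := hPa n
      have h10 := hea ⟨hx, hxx⟩ ⟨haU (n + 1), hxa _⟩ h1.le
      rw [abs_le]
      constructor <;> linarith
  · refine ⟨0, ?_, by simpa using (half_pos (he x hx)).le⟩
    have : ∀ k, c k * max (x - a k) 0 = 0 := fun k => by
      rw [max_eq_right (by linarith [hxa k]), mul_zero]
    simp_rw [this]
    exact hasSum_zero

/-! ### Assembling the approximation -/

theorem ConvexOn.exists_analytic_approx_right {U : Set ℝ} (hU : IsOpen U) (hUc : U.OrdConnected)
    {x₀ : ℝ} (hx₀ : x₀ ∈ U) {f : ℝ → ℝ} (hf : ConvexOn ℝ U f) (hf0 : ∀ x ∈ U, 0 ≤ f x)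
    (hfx : f x₀ = 0) {ε : ℝ → ℝ} (hε : ContinuousOn ε U) (hpos : ∀ x ∈ U, 0 < ε x) :
    ∃ g : ℝ → ℝ, AnalyticOnNhd ℝ g U ∧ ConvexOn ℝ U g ∧
      ∀ x ∈ U, |g x - (if x₀ ≤ x then f x else 0)| ≤ ε x := by
  obtain ⟨e, he, heε, he1, hea, hem⟩ := exists_unimodal_minorant hUc hx₀ hε hpos
  obtain ⟨w, hwa, hw0, hwe⟩ := exists_analytic_weight hU hUc he hea hem
  obtain ⟨a, c, hmono, ha0, haU, hesc, hc0, hs⟩ :=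
    hf.exists_sum_ramps hU hUc hx₀ hf0 hfx he hea
  have hL : IntegrableOn (fun t : ℝ => (1 + t ^ 2)⁻¹) U := integrable_inv_one_add_sq.integrableOn
  have hwm : AEStronglyMeasurable w (volume.restrict U) :=
    hwa.continuousOn.aestronglyMeasurable hU.measurableSet
  have hwL : ∀ t ∈ U, w t + |t| * w t ≤ (1 + t ^ 2)⁻¹ := by
    intro t ht
    have h1 := hwe t ht
    have h2 : e t * (1 + t ^ 2)⁻¹ ≤ 1 * (1 + t ^ 2)⁻¹ := by
      gcongr
      exact he1 t
    linarith
  have hw : IntegrableOn w U := by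
    refine Integrable.mono' hL hwm ((ae_restrict_mem hU.measurableSet).mono fun t ht => ?_)
    rw [Real.norm_of_nonneg (hw0 t).le]
    have := mul_nonneg (abs_nonneg t) (hw0 t).le
    linarith [hwL t ht]
  have hw1 : IntegrableOn (fun t => |t| * w t) U := by
    refine Integrable.mono' hL (continuous_abs.aestronglyMeasurable.mul hwm)
      ((ae_restrict_mem hU.measurableSet).mono fun t ht => ?_)
    rw [Real.norm_of_nonneg (mul_nonneg (abs_nonneg t) (hw0 t).le)]
    linarith [hwL t ht, hw0 t]
  -- Chosen so that Σ c_k δ_k ≤ 1/2: smoothing all ramps costs at most e/2, and the polygon costs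
  -- the other e/2.
  set δ : ℕ → ℝ := fun k => 1 / 4 * (1 / 2) ^ k / (1 + c k) with hδ
  have hc1 : ∀ k, 0 < 1 + c k := fun k => by linarith [hc0 k]
  have hδ0 : ∀ k, 0 < δ k := fun k => div_pos (by positivity) (hc1 k)
  have hcδ : ∀ k, c k * δ k ≤ 1 / 4 * (1 / 2) ^ k := by
    intro k
    calc c k * δ k ≤ (1 + c k) * δ k := mul_le_mul_of_nonneg_right (by linarith) (hδ0 k).le
      _ = 1 / 4 * (1 / 2) ^ k := mul_div_cancel₀ _ (hc1 k).ne'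
  have hgeo : HasSum (fun k : ℕ => 1 / 4 * (1 / 2 : ℝ) ^ k) (1 / 2) := by
    have := hasSum_geometric_two.mul_left (1 / 4 : ℝ)
    norm_num at this ⊢
    exact this
  have hbump := fun k => exists_bump_ramp hU he he1 hea hem hw0 hw hw1 hwe (haU k)
    (ha0 ▸ hmono k.zero_le) (hδ0 k) (show (0 : ℝ) < 1 / ((k : ℝ) + 1) by positivity)
  choose Φ φ hb hz herr using hbump
  set S : ℝ → ℝ := fun t => ∑' k, c k * φ k t with hS
  have hSa : AnalyticOnNhd ℝ S U := by
    intro x hx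
    obtain ⟨r, hr, hrU⟩ := Metric.isOpen_iff.1 hU x hx
    have hyU : x + r / 2 ∈ U := hrU (by
      rw [Metric.mem_ball, Real.dist_eq, add_sub_cancel_left, abs_of_pos (by linarith)]; linarith)
    obtain ⟨m, hm⟩ := hesc _ hyU
    obtain ⟨j, hj⟩ := exists_nat_one_div_lt (show 0 < r / 10 by positivity)
    -- For large k one has a_k > x + r/2, so on the ball of radius r/10 the distance |Re z - a_k| is
    -- at least 4r/10. This puts z in the sector where `Φ k` is small, and it exceeds the excluded
    -- radius 1/(k+1).
    refine (analyticAt_tsum_ofReal (F := fun k z => c k * Φ k z) (N := max m j)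
      (V := Metric.ball (x : ℂ) (r / 10))
      (fun k => (hb k).differentiable.const_mul _) (fun k t => by rw [(hb k).ofReal]; push_cast; rfl)
      hgeo.summable Metric.isOpen_ball ?_ (Metric.mem_ball_self (by positivity))).2
    intro k hk z hzb
    rw [mem_ball_iff_norm] at hzb
    have h1 : |z.re - x| < r / 10 := by
      simpa using (Complex.abs_re_le_norm (z - x)).trans_lt hzb
    have h2 : |z.im| < r / 10 := by
      simpa using (Complex.abs_im_le_norm (z - x)).trans_lt hzb
    have h3 : a m ≤ a k := hmono ((le_max_left _ _).trans hk)
    have h4 : 4 * (r / 10) ≤ |z.re - a k| := by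
      rw [abs_sub_comm]
      refine le_trans ?_ (le_abs_self _)
      have := (abs_lt.1 h1).2
      linarith
    have h5 : 1 / ((k : ℝ) + 1) ≤ 1 / ((j : ℝ) + 1) := by
      have : j ≤ k := (le_max_right _ _).trans hk
      gcongr
    rw [norm_mul, Complex.norm_real, Real.norm_of_nonneg (hc0 k)]
    exact (mul_le_mul_of_nonneg_left (hz k z (by linarith) (by linarith)) (hc0 k)).trans (hcδ k)
  set G : ℝ → ℝ := fun t => w t * S t with hG
  have hGa : AnalyticOnNhd ℝ G U := hwa.mul hSa
  have hG0 : ∀ t, 0 ≤ G t := fun t =>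
    mul_nonneg (hw0 t).le (tsum_nonneg fun k => mul_nonneg (hc0 k) ((hb k).nonneg t))
  set F : ℝ → ℕ → ℝ → ℝ := fun x k t => c k * (max (x - t) 0 * (w t * φ k t)) with hF
  have hF0 : ∀ x k t, 0 ≤ F x k t := fun x k t => mul_nonneg (hc0 k)
    (mul_nonneg (le_max_right _ _) (mul_nonneg (hw0 t).le ((hb k).nonneg t)))
  have hFG : ∀ x t, ∑' k, F x k t = max (x - t) 0 * G t := by
    intro x t
    have : ∀ k, F x k t = max (x - t) 0 * w t * (c k * φ k t) := fun k => by
      simp only [hF]; ring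
    simp_rw [this]
    rw [tsum_mul_left]
    simp only [hG, hS]
    ring
  have hFi : ∀ x k, IntegrableOn (F x k) U := by
    intro x k
    have h1 : IntegrableOn (fun t => max (x - t) 0 * w t) U := by
      refine Integrable.mono' ((hw.const_mul |x|).add hw1)
        ((by fun_prop : Continuous fun t : ℝ => max (x - t) 0).aestronglyMeasurable.mul hwm)
        (Eventually.of_forall fun t => ?_)
      change ‖max (x - t) 0 * w t‖ ≤ |x| * w t + |t| * w t
      rw [norm_mul, Real.norm_of_nonneg (hw0 t).le, Real.norm_of_nonneg (le_max_right _ _),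
        ← add_mul]
      refine mul_le_mul_of_nonneg_right (max_le ?_ (by positivity)) (hw0 t).le
      linarith [le_abs_self x, neg_abs_le t]
    refine (((hb k).integrableOn_mul h1).const_mul (c k)).congr (Eventually.of_forall fun t => ?_)
    simp only [hF]
    ring
  have hdiff : ∀ x ∈ U, ∀ k, ‖(∫ t in U, F x k t) - c k * max (x - a k) 0‖ ≤
      1 / 4 * (1 / 2) ^ k * e x := by
    intro x hx k
    simp only [hF]
    rw [integral_const_mul, ← mul_sub, norm_mul, Real.norm_of_nonneg (hc0 k), Real.norm_eq_abs]
    calc _ ≤ c k * (δ k * e x) := mul_le_mul_of_nonneg_left (herr k x hx) (hc0 k)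
      _ = c k * δ k * e x := by ring
      _ ≤ _ := mul_le_mul_of_nonneg_right (hcδ k) (he x hx).le
  have hsummable : ∀ x ∈ U, Summable fun k => ∫ t in U, F x k t := by
    intro x hx
    obtain ⟨s, hs1, -⟩ := hs x hx
    have h1 := Summable.of_norm_bounded (hgeo.summable.mul_right (e x)) (hdiff x hx)
    simpa using h1.add hs1.summable
  have hnorm : ∀ x k, ∫ t in U, ‖F x k t‖ = ∫ t in U, F x k t := fun x k => by
    simp_rw [Real.norm_of_nonneg (hF0 x k _)]
  have hint : ∀ x ∈ U, IntegrableOn (fun t => max (x - t) 0 * G t) U := by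
    intro x hx
    refine ⟨(by fun_prop : Continuous fun t : ℝ => max (x - t) 0).aestronglyMeasurable.mul
      (hGa.continuousOn.aestronglyMeasurable hU.measurableSet), ?_⟩
    have := hasFiniteIntegral_tsum_of_summable_integral_norm (hFi x)
      (by simpa only [hnorm] using hsummable x hx)
    simpa only [hFG] using this
  refine ⟨fun x => ∫ t in U, max (x - t) 0 * G t,
    analyticOnNhd_integral_max_sub_mul hU hUc hGa hint,
    convexOn_integral_max_sub_mul hUc hG0 hint, fun x hx => ?_⟩
  obtain ⟨s, hs1, hs2⟩ := hs x hx
  have h1 : HasSum (fun k => ∫ t in U, F x k t) (∫ t in U, max (x - t) 0 * G t) := by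
    have := hasSum_integral_of_summable_integral_norm (hFi x)
      (by simpa only [hnorm] using hsummable x hx)
    simpa only [hFG] using this
  have h2 : |(∫ t in U, max (x - t) 0 * G t) - s| ≤ 1 / 2 * e x := by
    rw [← Real.norm_eq_abs, ← (h1.sub hs1).tsum_eq]
    exact tsum_of_norm_bounded (hgeo.mul_right (e x)) (hdiff x hx)
  refine (abs_sub_le _ s _).trans ?_
  have := heε x hx
  linarith

theorem ConvexOn.exists_supporting_slope {U : Set ℝ} (hU : IsOpen U) {f : ℝ → ℝ}
    (hf : ConvexOn ℝ U f) {x₀ : ℝ} (hx₀ : x₀ ∈ U) :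
    ∃ m, ∀ x ∈ U, f x₀ + m * (x - x₀) ≤ f x := by
  have hi : x₀ ∈ interior U := by rwa [hU.interior_eq]
  refine ⟨derivWithin f (Ioi x₀) x₀, fun x hx => ?_⟩
  rcases lt_trichotomy x x₀ with h | rfl | h
  · have h1 := (hf.slope_le_leftDeriv_of_mem_interior hx hi h).trans
      (hf.leftDeriv_le_rightDeriv_of_mem_interior hi)
    rw [slope_def_field, div_le_iff₀ (by linarith)] at h1
    linarith
  · simp
  · have h1 := hf.rightDeriv_le_slope_of_mem_interior hi hx h
    rw [slope_def_field, le_div_iff₀ (by linarith)] at h1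
    linarith

theorem mainTheorem8 (U : Set ℝ) (hUopen : IsOpen U) (hUint : U.OrdConnected)
    (f : ℝ → ℝ) (hf : ConvexOn ℝ U f)
    (ε : ℝ → ℝ) (hεcont : ContinuousOn ε U) (hεpos : ∀ x ∈ U, 0 < ε x) :
    ∃ g : ℝ → ℝ, AnalyticOnNhd ℝ g U ∧ ConvexOn ℝ U g ∧ ∀ x ∈ U, |f x - g x| ≤ ε x := by
  rcases U.eq_empty_or_nonempty with rfl | ⟨x₀, hx₀⟩
  · exact ⟨f, by simp [AnalyticOnNhd], hf, by simp⟩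
  obtain ⟨m, hm⟩ := hf.exists_supporting_slope hUopen hx₀
  have hc : Convex ℝ U := hf.1
  have hnc : Convex ℝ (-U) := hc.neg
  set f₁ : ℝ → ℝ := fun x => f x - (f x₀ + m * (x - x₀)) with hf₁
  have hf₁c : ConvexOn ℝ U f₁ := by
    refine ⟨hc, fun x hx y hy a b ha hb hab => ?_⟩
    have := hf.2 hx hy ha hb hab
    simp only [hf₁, smul_eq_mul] at this ⊢
    linear_combination this + (f x₀ - m * x₀) * hab
  have hf₁0 : ∀ x ∈ U, 0 ≤ f₁ x := fun x hx => sub_nonneg.2 (hm x hx)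
  have hf₁x : f₁ x₀ = 0 := by simp [hf₁]
  have hneg : ∀ {y : ℝ}, y ∈ -U → -y ∈ U := fun h => h
  have hnegc : ∀ {h : ℝ → ℝ} {V : Set ℝ}, ConvexOn ℝ V h → ConvexOn ℝ (-V) fun y => h (-y) := by
    intro h V hh
    refine ⟨hh.1.neg, fun x hx y hy a b ha hb hab => ?_⟩
    have := hh.2 (Set.mem_neg.1 hx) (Set.mem_neg.1 hy) ha hb hab
    rwa [smul_neg, smul_neg, ← neg_add] at this
  have hε2 : ContinuousOn (fun x => ε x / 2) U := hεcont.div_const 2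
  obtain ⟨g₁, hg₁a, hg₁c, hg₁⟩ := hf₁c.exists_analytic_approx_right hUopen hUint hx₀ hf₁0 hf₁x
    hε2 fun x hx => half_pos (hεpos x hx)
  obtain ⟨g₂, hg₂a, hg₂c, hg₂⟩ := (hnegc hf₁c).exists_analytic_approx_right (x₀ := -x₀) hUopen.neg
    hnc.ordConnected (by simpa using hx₀) (fun y hy => hf₁0 _ (hneg hy)) (by simpa using hf₁x)
    (ε := fun y => ε (-y) / 2)
    (hε2.comp continuous_neg.continuousOn fun y hy => hneg hy)
    fun y hy => half_pos (hεpos _ (hneg hy))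
  have hg₂c' : ConvexOn ℝ U fun x => g₂ (-x) := by simpa using hnegc hg₂c
  refine ⟨fun x => f x₀ + m * (x - x₀) + (g₁ x + g₂ (-x)), fun x hx => ?_, ?_, fun x hx => ?_⟩
  · refine AnalyticAt.add (by fun_prop) ((hg₁a x hx).add ?_)
    exact (hg₂a (-x) (by simpa using hx)).fun_comp analyticAt_id.neg
  · refine ⟨hc, fun x hx y hy a b ha hb hab => ?_⟩
    have h1 := hg₁c.2 hx hy ha hb hab
    have h2 := hg₂c'.2 hx hy ha hb hab
    simp only [smul_eq_mul] at h1 h2 ⊢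
    linear_combination h1 + h2 - (f x₀ - m * x₀) * hab
  · have h1 := hg₁ x hx
    have h2 := hg₂ (-x) (by simpa using hx)
    simp only [neg_neg, neg_le_neg_iff] at h2
    -- Both halves include x₀, harmlessly because `f₁` vanishes there.
    have h3 : (if x₀ ≤ x then f₁ x else 0) + (if x ≤ x₀ then f₁ x else 0) = f₁ x := by
      rcases lt_trichotomy x x₀ with h | rfl | h
      · rw [if_neg (not_le.2 h), if_pos h.le, zero_add]
      · simp [hf₁x]
      · rw [if_pos h.le, if_neg (not_le.2 h), add_zero]
    have h4 : f₁ x = f x - (f x₀ + m * (x - x₀)) := rfl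
    rw [abs_le] at h1 h2 ⊢
    constructor <;> linarith
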